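/- There is a function $f:\mathbb N\to\mathbb N$ with $f(k)=k^{O(k^2)}$ (that is, for some constant $c$, $f(k)\le k^{ck^2}$ for all $k\ge 2$) such that the following holds for every $k\in\mathbb N$. Let $G$ be a finite simple planar graph, and let $\chi$ assign to each vertex of $G$ a finite set of colors (natural numbers). For a walk $W$ let $\chi(W)$ be the union of the sets $\chi(x)$ over the vertices $x$ of $W$. Suppose that $G$ is color-connected (for every color $c$ that appears on some vertex, the vertices $x$ with $c\in\chi(x)$ induce a connected subgraph of $G$) and irreducible with respect to color contraction (no two adjacent vertices $x,y$ satisfy $\chi(x)=\chi(y)$). Let $s,v$ be vertices of $G$ and let $\mathbf P$ be a set of $s$-$v$ paths in $G$ that are pairwise color-disjoint ($\chi(P)\cap\chi(P')=\emptyset$ for distinct $P,P'\in\mathbf P$) and $k$-valid ($|\chi(P)|\le k$ for each $P\in\mathbf P$). Consider the following path-refining algorithm. Start with $U=\emptyset$ and $\mathbf Q=\mathbf P$. Repeat: let $u$ be a vertex in $V(G)\setminus U$ that is contained in the highest number of paths in $\mathbf Q$ (ties are broken arbitrarily); if $u$ is contained in more than $$\frac{|\mathbf Q|}{(|U|+1)!\,(8k^2+8k+3)}$$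 paths of $\mathbf Q$, add $u$ to $U$, restrict $\mathbf Q$ to the paths that contain $u$, and repeat; otherwise (or if $U=V(G)$) stop. If $|\mathbf P|\ge f(k)$, then the algorithm terminates, and, however ties are broken, $|U|<2k+1$ when it terminates. -/

import Mathlib

open scoped Nat unitInterval

/-- A drawing of the simple graph `G` in the Euclidean plane: vertices are distinct points, edges
are simple (injective, continuous) arcs joining the points of their two ends, no arc passes
through a vertex in its interior, and arcs of distinct edges are disjoint except at their ends. -/
structure PlaneDrawing {V : Type*} (G : SimpleGraph V) where
  point : V → EuclideanSpace ℝ (Fin 2)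
  point_injective : Function.Injective point
  arc : G.edgeSet → I → EuclideanSpace ℝ (Fin 2)
  arc_continuous : ∀ e, Continuous (arc e)
  arc_injective : ∀ e, Function.Injective (arc e)
  arc_ends : ∀ e : G.edgeSet, ∃ x y : V,
    (e : Sym2 V) = s(x, y) ∧ arc e 0 = point x ∧ arc e 1 = point y
  arc_interior_ne_point : ∀ (e : G.edgeSet) (a : I), a ≠ 0 → a ≠ 1 → ∀ x : V, arc e a ≠ point x
  arc_interior_disjoint : ∀ e e' : G.edgeSet, e ≠ e' →
    ∀ a a' : I, a ≠ 0 → a ≠ 1 → a' ≠ 0 → a' ≠ 1 → arc e a ≠ arc e' a'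

/-- A graph is planar if it has a drawing in the plane. -/
def IsPlanar {V : Type*} (G : SimpleGraph V) : Prop :=
  Nonempty (PlaneDrawing G)

/-- Every color is connected: the vertices carrying it induce a connected subgraph
(the condition is void for a color that appears on no vertex). -/
def ColorConnected {V : Type*} (G : SimpleGraph V) (χ : V → Finset ℕ) : Prop :=
  ∀ c : ℕ, (G.induce {x : V | c ∈ χ x}).Preconnected

/-- Irreducible with respect to color contraction: adjacent vertices never carry the same
color set. -/
def ColorIrreducible {V : Type*} (G : SimpleGraph V) (χ : V → Finset ℕ) : Prop :=
  ∀ x y : V, G.Adj x y → χ x ≠ χ y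

/-- The set of colors appearing on the vertices of a walk. -/
def walkColors {V : Type*} [DecidableEq V] {G : SimpleGraph V} (χ : V → Finset ℕ) {x y : V}
    (W : G.Walk x y) : Finset ℕ :=
  W.support.toFinset.biUnion χ

/-- The walk uses at most `k` colors. -/
def IsValidWalk {V : Type*} [DecidableEq V] {G : SimpleGraph V} (χ : V → Finset ℕ) (k : ℕ)
    {x y : V} (W : G.Walk x y) : Prop :=
  (walkColors χ W).card ≤ k

/-- Any two distinct paths of the family have disjoint color sets. -/
def PairwiseColorDisjoint {V : Type*} [DecidableEq V] {G : SimpleGraph V} (χ : V → Finset ℕ)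
    {s v : V} (P : Finset (G.Path s v)) : Prop :=
  ∀ p ∈ P, ∀ q ∈ P, p ≠ q → Disjoint (walkColors χ p.1) (walkColors χ q.1)

/-- The paths of `Q` that contain the vertex `u`. -/
def pathsThrough {V : Type*} [DecidableEq V] {G : SimpleGraph V} {s v : V}
    (Q : Finset (G.Path s v)) (u : V) : Finset (G.Path s v) :=
  Q.filter (fun p => u ∈ p.1.support)

/-- The two variables `U` and `Q` of the path-refining algorithm. -/
structure RefineState {V : Type*} (G : SimpleGraph V) (s v : V) where
  U : Finset V
  Q : Finset (G.Path s v)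

/-- The initial values `U = ∅`, `Q = P`. -/
def refineInit {V : Type*} {G : SimpleGraph V} {s v : V} (P : Finset (G.Path s v)) :
    RefineState G s v :=
  ⟨∅, P⟩

/-- One successful pass of the loop from `a` to `b`: a vertex `u` outside `U` contained in the
highest number of paths of `Q` (ties broken arbitrarily) lies on more than
`|Q| / ((|U| + 1)! (8 k ^ 2 + 8 k + 3))` of them; it is added to `U`, and `Q` is restricted to the
paths through `u`. -/
def RefineStep {V : Type*} [DecidableEq V] {G : SimpleGraph V} {s v : V} (k : ℕ)
    (a b : RefineState G s v) : Prop :=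
  ∃ u : V, u ∉ a.U ∧
    (∀ w : V, w ∉ a.U → (pathsThrough a.Q w).card ≤ (pathsThrough a.Q u).card) ∧
    (a.Q.card : ℚ) / (((a.U.card + 1)! : ℚ) * (8 * (k : ℚ) ^ 2 + 8 * (k : ℚ) + 3)) <
      ((pathsThrough a.Q u).card : ℚ) ∧
    b = ⟨insert u a.U, pathsThrough a.Q u⟩

/-- The algorithm started on `P` can end with the values `a`: they are reached by finitely many
passes of the loop, and no further pass is possible. -/
def RefineOutput {V : Type*} [DecidableEq V] {G : SimpleGraph V} {s v : V} (k : ℕ)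
    (P : Finset (G.Path s v)) (a : RefineState G s v) : Prop :=
  Relation.ReflTransGen (RefineStep k) (refineInit P) a ∧ ∀ b, ¬ RefineStep k a b

/-- The algorithm started on `P` always stops: there is no infinite sequence of passes. -/
def RefineTerminates {V : Type*} [DecidableEq V] {G : SimpleGraph V} {s v : V} (k : ℕ)
    (P : Finset (G.Path s v)) : Prop :=
  ¬ ∃ run : ℕ → RefineState G s v, run 0 = refineInit P ∧ ∀ n, RefineStep k (run n) (run (n + 1))

/-! Each pass shrinks `Q` by at most the factor `refineFactor k` while |U| ≤ 2k. So if |U| reached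
2k+1, more than 4(2k+1)² paths would still share all of `U`. Color-disjointness makes the vertices
of `U` colorless, and irreducibility then makes all their neighbors colored.

On one path, let every vertex of `U` pick a color of a neighbor on the path. With at most k colors,
three vertices pick the same color, and the middle one gives a back link in one of the two
directions (`exists_backLinked`). Among so many paths, three agree on the linked pair (w, w') and
the direction. The end where these paths start, w and w' on one side, and the predecessors of w on
the other, then form a K₃,₃ whose edges are path prefixes, edges at w, and color classes
(`IsPlanar.no_color_linked_triple`).

Planarity of K₃,₃ is refuted by winding: `logChange_square` gives one integer equation for each pair
of independent edges, and the equations are inconsistent mod 2 (`K33_curves_meet`). -/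

/-! ### Continuous logarithms along plane curves -/

open Complex in
theorem exists_continuous_log_comp (f : ℝ × ℝ → ℂ) (hf : Continuous f) (h0 : ∀ z, f z ≠ 0) :
    ∃ L : ℝ × ℝ → ℂ, Continuous L ∧ ∀ z, exp (L z) = f z := by
  obtain ⟨F, ⟨-, hF⟩, -⟩ := isCoveringMapOn_exp.existsUnique_continuousMap_lifts
    ⟨f, hf⟩ (e₀ := log (f 0)) (a₀ := 0) (exp_log (h0 0)) (by rintro _; simpa using h0 _)
  exact ⟨F, F.continuous, fun z => congr_fun hF z⟩

/-- The change along `[0, 1]` of a continuous logarithm of `g`. -/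
noncomputable def logChange (g : ℝ → ℂ) : ℂ :=
  open Classical in
  if h : ∃ l : ℝ → ℂ, Continuous l ∧ ∀ t, Complex.exp (l t) = g t
  then h.choose 1 - h.choose 0 else 0

theorem sub_eq_sub_of_exp_eq_mul_exp {f g : ℝ → ℂ} (hf : Continuous f) (hg : Continuous g) (c : ℂ)
    (h : ∀ t, Complex.exp (f t) = c * Complex.exp (g t)) : f 1 - f 0 = g 1 - g 0 := by
  have hc : c = Complex.exp (f 0 - g 0) := by
    rw [Complex.exp_sub, h 0, mul_div_cancel_right₀ _ (Complex.exp_ne_zero _)]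
  have := Complex.isCoveringMap_exp.eq_of_comp_eq hf
    (g₂ := fun t => (f 0 - g 0) + g t) (by fun_prop)
    (by ext t; simp [h t, Complex.exp_add, hc]) 0 (by simp)
  rw [congr_fun this 1]; ring

/-- Continuous logarithms of `g` and of `c * g` differ by a constant, so any of them computes the
change. The case c = -1 exchanges the curve and the viewpoint. -/
theorem logChange_eq {g l : ℝ → ℂ} {c : ℂ} (hc : c ≠ 0) (hl : Continuous l)
    (h : ∀ t, Complex.exp (l t) = c * g t) : logChange g = l 1 - l 0 := by
  have hex : ∃ l : ℝ → ℂ, Continuous l ∧ ∀ t, Complex.exp (l t) = g t :=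
    ⟨fun t => l t - Complex.log c, by fun_prop, fun t => by
      rw [Complex.exp_sub, h, Complex.exp_log hc, mul_div_cancel_left₀ _ hc]⟩
  rw [logChange, dif_pos hex]
  refine (sub_eq_sub_of_exp_eq_mul_exp hl hex.choose_spec.1 c fun t => ?_).symm
  rw [h, hex.choose_spec.2]

/-- For two disjoint curves `e`, `f`, the changes of argument of one seen from the ends of the
other are related. -/
theorem logChange_square {e f : ℝ → ℂ} (he : Continuous e) (hf : Continuous f)
    (h : ∀ s t, e s ≠ f t) :
    logChange (fun t => f t - e 1) - logChange (fun t => f t - e 0) =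
      logChange (fun t => e t - f 1) - logChange (fun t => e t - f 0) := by
  -- With one logarithm on the whole parameter plane, both sides become the same alternating sum of
  -- `L` over the corners of the unit square.
  obtain ⟨L, hL, hexp⟩ := exists_continuous_log_comp (fun z => f z.2 - e z.1) (by fun_prop)
    (fun z => sub_ne_zero.2 (h _ _).symm)
  rw [logChange_eq (l := fun t => L (1, t)) one_ne_zero (by fun_prop) (by simp [hexp]),
    logChange_eq (l := fun t => L (0, t)) one_ne_zero (by fun_prop) (by simp [hexp]),
    logChange_eq (l := fun t => L (t, 1)) (neg_ne_zero.2 one_ne_zero) (by fun_prop)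
      (by simp [hexp]),
    logChange_eq (l := fun t => L (t, 0)) (neg_ne_zero.2 one_ne_zero) (by fun_prop)
      (by simp [hexp])]
  ring

theorem exp_logChange {f : ℝ → ℂ} (hf : Continuous f) {z : ℂ} (h : ∀ t, f t ≠ z) :
    Complex.exp (logChange (fun t => f t - z)) = (f 1 - z) / (f 0 - z) := by
  obtain ⟨L, hL, hexp⟩ := exists_continuous_log_comp (fun z' => f z'.1 - z) (by fun_prop)
    (fun z' => sub_ne_zero.2 (h _))
  rw [logChange_eq (l := fun t => L (t, 0)) one_ne_zero (by fun_prop) (by simp [hexp]),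
    Complex.exp_sub, hexp, hexp]

/-! ### K₃,₃ is not planar: a parity count -/

/-- An antisymmetric choice of logarithms of the differences of distinct points. -/
noncomputable def logDiff (X : Fin 3 → ℂ) (i j : Fin 3) : ℂ :=
  if i < j then Complex.log (X j - X i) else Complex.log (X i - X j) + Real.pi * Complex.I

theorem exp_logDiff {X : Fin 3 → ℂ} {i j : Fin 3} (h : X i ≠ X j) :
    Complex.exp (logDiff X i j) = X j - X i := by
  unfold logDiff
  split_ifs
  · exact Complex.exp_log (sub_ne_zero.2 h.symm)
  · rw [Complex.exp_add, Complex.exp_log (sub_ne_zero.2 h), Complex.exp_pi_mul_I]; ring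

theorem logDiff_swap {X : Fin 3 → ℂ} {i j : Fin 3} (h : i < j) :
    logDiff X j i = logDiff X i j + Real.pi * Complex.I := by
  simp [logDiff, h, h.not_gt]

theorem exists_eq_sub_add_of_exp_eq_div {a b c : ℂ}
    (h : Complex.exp a = Complex.exp b / Complex.exp c) :
    ∃ n : ℤ, a = b - c + n * (2 * Real.pi * Complex.I) := by
  rw [← Complex.exp_sub, Complex.exp_eq_exp_iff_exists_int] at h
  exact h

/-- Any drawing of `K₃,₃` by curves in the plane has two non-adjacent edges that meet. -/
theorem K33_curves_meet (X Y : Fin 3 → ℂ) (g : Fin 3 → Fin 3 → ℝ → ℂ)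
    (hg : ∀ i j, Continuous (g i j)) (h0 : ∀ i j, g i j 0 = X i) (h1 : ∀ i j, g i j 1 = Y j)
    (hd : ∀ i j i' j', i ≠ i' → j ≠ j' → ∀ s t, g i j s ≠ g i' j' t) : False := by
  have hother : ∀ i : Fin 3, ∃ j, j ≠ i := by decide
  have hX : ∀ i i' j', i ≠ i' → ∀ t, g i' j' t ≠ X i := by
    intro i i' j' h t
    obtain ⟨j, hj⟩ := hother j'
    rw [← h0 i j]
    exact (hd i j i' j' h hj 0 t).symm
  have hY : ∀ j i' j', j ≠ j' → ∀ t, g i' j' t ≠ Y j := by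
    intro j i' j' h t
    obtain ⟨i, hi⟩ := hother i'
    rw [← h1 i j]
    exact (hd i j i' j' hi h 1 t).symm
  have hXX : ∀ i i', i ≠ i' → X i ≠ X i' := fun i i' h => by
    rw [← h0 i' 0]; exact (hX i i' 0 h 0).symm
  have hYY : ∀ i i', i ≠ i' → Y i ≠ Y i' := fun i i' h => by
    rw [← h1 0 i']; exact (hY i 0 i' h 1).symm
  have hXY : ∀ i j, Y j - X i ≠ 0 := fun i j => by
    obtain ⟨i', hi⟩ := hother i
    rw [← h1 i' j, sub_ne_zero]; exact hX i i' j hi.symm 1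
  -- The endpoints determine each change up to a multiple of 2πi; `n` and `m` record these
  -- multiples.
  have hn : ∀ i i' j', ∃ n : ℤ, i ≠ i' → logChange (fun t => g i' j' t - X i) =
      Complex.log (Y j' - X i) - logDiff X i i' + n * (2 * Real.pi * Complex.I) := by
    intro i i' j'
    by_cases h : i = i'
    · exact ⟨0, fun h' => (h' h).elim⟩
    obtain ⟨n, hn⟩ := exists_eq_sub_add_of_exp_eq_div
      (a := logChange (fun t => g i' j' t - X i)) (b := Complex.log (Y j' - X i))
      (c := logDiff X i i') (by
        rw [exp_logChange (hg _ _) (hX i i' j' h), h0, h1, Complex.exp_log (hXY _ _),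
          exp_logDiff (hXX _ _ h)])
    exact ⟨n, fun _ => hn⟩
  have hm : ∀ j i' j', ∃ n : ℤ, j ≠ j' → logChange (fun t => g i' j' t - Y j) =
      logDiff Y j j' - (Complex.log (Y j - X i') + Real.pi * Complex.I)
        + n * (2 * Real.pi * Complex.I) := by
    intro j i' j'
    by_cases h : j = j'
    · exact ⟨0, fun h' => (h' h).elim⟩
    obtain ⟨n, hn⟩ := exists_eq_sub_add_of_exp_eq_div
      (a := logChange (fun t => g i' j' t - Y j)) (b := logDiff Y j j')
      (c := Complex.log (Y j - X i') + Real.pi * Complex.I) (by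
        rw [exp_logChange (hg _ _) (hY j i' j' h), h0, h1, Complex.exp_add,
          Complex.exp_log (hXY _ _), exp_logDiff (hYY _ _ h), Complex.exp_pi_mul_I]
        congr 1; ring)
    exact ⟨n, fun _ => hn⟩
  choose n hn using hn
  choose m hm using hm
  -- The logarithms of `Y j - X i` cancel. Each remaining difference of `logDiff` is ±πi, with sign
  -- given by the order of the indices.
  have hsq : ∀ i j i' j', i ≠ i' → j ≠ j' →
      logDiff Y j j' - logDiff Y j' j + (logDiff X i i' - logDiff X i' i) +
        ((m j i' j' - n i i' j' - m j' i j + n i' i j : ℤ) : ℂ) * (2 * Real.pi * Complex.I)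
        = 0 := by
    intro i j i' j' hi hj
    have := logChange_square (hg i j) (hg i' j') (hd i j i' j' hi hj)
    rw [h0, h1, h0, h1, hn _ _ _ hi, hn _ _ _ hi.symm, hm _ _ _ hj, hm _ _ _ hj.symm] at this
    push_cast
    linear_combination this
  have hpi : (2 * Real.pi * Complex.I : ℂ) ≠ 0 := by simp [Real.pi_ne_zero]
  have hlt : ∀ i j i' j', i < i' → j < j' →
      m j i' j' - n i i' j' - m j' i j + n i' i j = 1 := by
    intro i j i' j' hi hj
    have := hsq i j i' j' hi.ne hj.ne
    rw [logDiff_swap hi, logDiff_swap hj] at this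
    have h2 : ((m j i' j' - n i i' j' - m j' i j + n i' i j : ℤ) : ℂ) = 1 := by
      apply mul_right_cancel₀ hpi
      linear_combination this
    exact_mod_cast h2
  have hgt : ∀ i j i' j', i < i' → j' < j →
      m j i' j' - n i i' j' - m j' i j + n i' i j = 0 := by
    intro i j i' j' hi hj
    have := hsq i j i' j' hi.ne hj.ne'
    rw [logDiff_swap hi, logDiff_swap hj] at this
    have h2 : ((m j i' j' - n i i' j' - m j' i j + n i' i j : ℤ) : ℂ) = 0 := by
      apply mul_right_cancel₀ hpi
      linear_combination this
    exact_mod_cast h2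
  have a1 := hlt 0 0 1 1 (by decide) (by decide)
  have a2 := hlt 0 0 1 2 (by decide) (by decide)
  have a3 := hlt 0 1 1 2 (by decide) (by decide)
  have a4 := hlt 0 0 2 1 (by decide) (by decide)
  have a5 := hlt 0 0 2 2 (by decide) (by decide)
  have a6 := hlt 0 1 2 2 (by decide) (by decide)
  have a7 := hlt 1 0 2 1 (by decide) (by decide)
  have a8 := hlt 1 0 2 2 (by decide) (by decide)
  have a9 := hlt 1 1 2 2 (by decide) (by decide)
  have b1 := hgt 0 1 1 0 (by decide) (by decide)
  have b2 := hgt 0 2 1 0 (by decide) (by decide)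
  have b3 := hgt 0 2 1 1 (by decide) (by decide)
  have b4 := hgt 0 1 2 0 (by decide) (by decide)
  have b5 := hgt 0 2 2 0 (by decide) (by decide)
  have b6 := hgt 0 2 2 1 (by decide) (by decide)
  have b7 := hgt 1 1 2 0 (by decide) (by decide)
  have b8 := hgt 1 2 2 0 (by decide) (by decide)
  have b9 := hgt 1 2 2 1 (by decide) (by decide)
  -- Each integer `n i i' j'` or `m j i' j'` occurs in exactly two of the 18 equations, so the left
  -- sides add up to an even number, while nine right sides are 1 and nine are 0.
  omega

/-- The same in the Euclidean plane, for curves staying in prescribed sets. -/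
theorem K33_joinedIn_sets_meet (X Y : Fin 3 → EuclideanSpace ℝ (Fin 2))
    (F : Fin 3 → Fin 3 → Set (EuclideanSpace ℝ (Fin 2)))
    (hF : ∀ i j, JoinedIn (F i j) (X i) (Y j))
    (hd : ∀ i j i' j', i ≠ i' → j ≠ j' → Disjoint (F i j) (F i' j')) : False := by
  let T := Complex.orthonormalBasisOneI.repr.symm
  refine K33_curves_meet (T ∘ X) (T ∘ Y) (fun i j t => T ((hF i j).somePath.extend t))
    (fun i j => by fun_prop) (fun i j => by simp) (fun i j => by simp) ?_
  intro i j i' j' hi hj s t h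
  refine Set.disjoint_left.1 (hd i j i' j' hi hj)
    ((hF i j).somePath_mem (Set.projIcc 0 1 zero_le_one s)) ?_
  have := T.injective h
  simp only [Path.extend, Set.IccExtend] at this
  erw [this]
  exact (hF i' j').somePath_mem _

/-! ### Vertex sets as regions of a drawing -/

namespace PlaneDrawing

variable {V : Type*} {G : SimpleGraph V}

/-- The part of the plane covered by the drawing of the subgraph induced on `S`. -/
def region (D : PlaneDrawing G) (S : Set V) : Set (EuclideanSpace ℝ (Fin 2)) :=
  {z | (∃ x ∈ S, D.point x = z) ∨ ∃ e : G.edgeSet, (∀ x ∈ (e : Sym2 V), x ∈ S) ∧ ∃ a, D.arc e a = z}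

/-- Endpoints of arcs count as vertices here, so the drawing axioms about arc interiors apply
directly. -/
theorem mem_region_iff (D : PlaneDrawing G) {S : Set V} {z : EuclideanSpace ℝ (Fin 2)} :
    z ∈ D.region S ↔ (∃ x ∈ S, D.point x = z) ∨
      ∃ e : G.edgeSet, (∀ x ∈ (e : Sym2 V), x ∈ S) ∧ ∃ a, a ≠ 0 ∧ a ≠ 1 ∧ D.arc e a = z := by
  constructor
  · rintro (h | ⟨e, he, a, rfl⟩)
    · exact Or.inl h
    obtain ⟨x, y, hxy, h0, h1⟩ := D.arc_ends e
    rw [hxy] at he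
    by_cases ha : a = 0
    · exact Or.inl ⟨x, he x (by simp), by rw [ha, h0]⟩
    by_cases ha1 : a = 1
    · exact Or.inl ⟨y, he y (by simp), by rw [ha1, h1]⟩
    exact Or.inr ⟨e, by rwa [hxy], a, ha, ha1, rfl⟩
  · rintro (h | ⟨e, he, a, -, -, rfl⟩)
    · exact Or.inl h
    · exact Or.inr ⟨e, he, a, rfl⟩

theorem disjoint_region (D : PlaneDrawing G) {S T : Set V} (h : Disjoint S T) :
    Disjoint (D.region S) (D.region T) := by
  rw [Set.disjoint_left]
  intro z hS hT
  rw [mem_region_iff] at hS hT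
  rcases hS with ⟨x, hx, rfl⟩ | ⟨e, he, a, ha0, ha1, rfl⟩ <;>
    rcases hT with ⟨y, hy, hxy⟩ | ⟨e', he', a', ha0', ha1', hxy⟩
  · exact Set.disjoint_left.1 h hx (D.point_injective hxy ▸ hy)
  · exact D.arc_interior_ne_point e' a' ha0' ha1' x hxy
  · exact D.arc_interior_ne_point e a ha0 ha1 y hxy.symm
  · by_cases hee : e = e'
    · subst hee
      obtain ⟨x, y, hxy', -⟩ := D.arc_ends e
      exact Set.disjoint_left.1 h (he x (by simp [hxy'])) (he' x (by simp [hxy']))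
    · exact D.arc_interior_disjoint e e' hee a a' ha0 ha1 ha0' ha1' hxy.symm

theorem joinedIn_region_of_adj (D : PlaneDrawing G) {S : Set V} {x y : V} (hx : x ∈ S)
    (hy : y ∈ S) (h : G.Adj x y) : JoinedIn (D.region S) (D.point x) (D.point y) := by
  obtain ⟨x', y', hxy, h0, h1⟩ := D.arc_ends ⟨s(x, y), h⟩
  have key : JoinedIn (D.region S) (D.point x') (D.point y') := by
    refine ⟨⟨⟨D.arc ⟨s(x, y), h⟩, D.arc_continuous _⟩, h0, h1⟩, fun t => Or.inr
      ⟨⟨s(x, y), h⟩, ?_, t, rfl⟩⟩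
    intro z hz
    rcases Sym2.mem_iff.1 hz with rfl | rfl <;> assumption
  rcases Sym2.eq_iff.1 hxy with ⟨rfl, rfl⟩ | ⟨rfl, rfl⟩
  · exact key
  · exact key.symm

theorem joinedIn_region_of_reachable (D : PlaneDrawing G) {S : Set V} {x y : S}
    (h : (G.induce S).Reachable x y) : JoinedIn (D.region S) (D.point x) (D.point y) := by
  obtain ⟨W⟩ := h
  induction W with
  | nil => exact JoinedIn.refl (Or.inl ⟨_, Subtype.coe_prop _, rfl⟩)
  | @cons x y z hxy _ ih => exact (D.joinedIn_region_of_adj x.2 y.2 hxy).trans ih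

end PlaneDrawing

/-! ### Back links along color-disjoint paths -/

/-- The configuration of connected sets `A j` from `s` to a neighbour `a j` of `w`, together with
the color classes `c j` joining `a j` to a neighbour `b j` of `w'`, gives a drawing of `K₃,₃`. -/
theorem IsPlanar.no_color_linked_triple {V : Type*} {G : SimpleGraph V} (hG : IsPlanar G)
    {χ : V → Finset ℕ} (hχ : ColorConnected G χ) {s w w' : V} {a b : Fin 3 → V} {c : Fin 3 → ℕ}
    {A : Fin 3 → Set V}
    (hA : ∀ j, ∃ (h : s ∈ A j) (h' : a j ∈ A j), (G.induce (A j)).Reachable ⟨s, h⟩ ⟨a j, h'⟩)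
    (hw : ∀ j, w ∉ A j) (hw' : ∀ j, w' ∉ A j) (hne : w ≠ w') (hwa : ∀ j, G.Adj w (a j))
    (hwb : ∀ j, G.Adj w' (b j)) (hca : ∀ j, c j ∈ χ (a j)) (hcb : ∀ j, c j ∈ χ (b j))
    (hcw : ∀ j, c j ∉ χ w) (hcw' : ∀ j, c j ∉ χ w')
    (hcA : ∀ i j, i ≠ j → ∀ x ∈ A i, c j ∉ χ x) : False := by
  obtain ⟨D⟩ := hG
  -- Only independent edges need disjoint regions, so the sets `A j` may overlap one another, as may
  -- the color classes.
  let S : Fin 3 → Fin 3 → Set V :=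
    fun i j => ![A j, {w, a j}, insert w' {x | c j ∈ χ x}] i
  refine K33_joinedIn_sets_meet (fun i => D.point (![s, w, w'] i)) (fun j => D.point (a j))
    (fun i j => D.region (S i j)) ?_ ?_
  · intro i j
    fin_cases i
    · obtain ⟨_, _, h⟩ := hA j
      exact D.joinedIn_region_of_reachable h
    · exact D.joinedIn_region_of_adj (by simp [S]) (by simp [S]) (hwa j)
    · have hb : b j ∈ S 2 j := by simp [S, hcb]
      refine (D.joinedIn_region_of_adj (S := S 2 j) (by simp [S]) hb (hwb j)).trans ?_
      refine (D.joinedIn_region_of_reachable (hχ (c j) ⟨b j, hcb j⟩ ⟨a j, hca j⟩)).mono ?_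
      rintro z (⟨x, hx, rfl⟩ | ⟨e, he, t⟩)
      · exact Or.inl ⟨x, Or.inr hx, rfl⟩
      · exact Or.inr ⟨e, fun x hx => Or.inr (he x hx), t⟩
  · have haA : ∀ j, a j ∈ A j := fun j => (hA j).2.1
    have haA' : ∀ i j, i ≠ j → a j ∉ A i := fun i j h h' => hcA i j h _ h' (hca j)
    have haw' : ∀ j, a j ≠ w' := fun j h => hw' j (h ▸ haA j)
    have h01 : ∀ i j, i ≠ j → Disjoint (S 0 i) (S 1 j) := by
      intro i j h
      rw [Set.disjoint_left]
      rintro x hx (rfl | rfl)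
      · exact hw i hx
      · exact haA' i j h hx
    have h02 : ∀ i j, i ≠ j → Disjoint (S 0 i) (S 2 j) := by
      intro i j h
      rw [Set.disjoint_left]
      rintro x hx (rfl | hx')
      · exact hw' i hx
      · exact hcA i j h x hx hx'
    have h12 : ∀ i j, i ≠ j → Disjoint (S 1 i) (S 2 j) := by
      intro i j h
      rw [Set.disjoint_left]
      rintro x (rfl | rfl) (h' | h')
      · exact hne h'
      · exact hcw j h'
      · exact haw' i h'
      · exact hcA i j h _ (haA i) h'
    intro i j i' j' hi hj
    apply D.disjoint_region
    fin_cases i <;> fin_cases i' <;> first | exact (hi rfl).elim | skip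
    · exact h01 _ _ hj
    · exact h02 _ _ hj
    · exact (h01 _ _ hj.symm).symm
    · exact h12 _ _ hj
    · exact (h02 _ _ hj.symm).symm
    · exact (h12 _ _ hj.symm).symm

/-- Some color of the vertex preceding `w` on the walk `p` also appears on a neighbour of `w'`,
a vertex that comes after `w` on `p`. -/
def BackLinked {V : Type*} {G : SimpleGraph V} (χ : V → Finset ℕ) {s v : V} (p : G.Walk s v)
    (w w' : V) : Prop :=
  ∃ i j c b, i + 1 < j ∧ j ≤ p.length ∧ p.getVert (i + 1) = w ∧ p.getVert j = w' ∧
    c ∈ χ (p.getVert i) ∧ c ∈ χ b ∧ G.Adj w' b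

theorem SimpleGraph.Walk.reachable_induce_getVert {V : Type*} {G : SimpleGraph V} {s v : V}
    (p : G.Walk s v) {S : Set V} {i : ℕ} (hi : i ≤ p.length) (h : ∀ t ≤ i, p.getVert t ∈ S) :
    ∃ (hs : s ∈ S) (h' : p.getVert i ∈ S), (G.induce S).Reachable ⟨s, hs⟩ ⟨p.getVert i, h'⟩ := by
  have hs : s ∈ S := by simpa using h 0 (Nat.zero_le _)
  refine ⟨hs, h i le_rfl, ?_⟩
  induction i with
  | zero =>
    simp only [SimpleGraph.Walk.getVert_zero]
    exact SimpleGraph.Reachable.rfl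
  | succ i ih =>
    refine (ih (by omega) fun t ht => h t (by omega)).trans (SimpleGraph.Adj.reachable ?_)
    exact p.adj_getVert_succ (by omega)

section

variable {V : Type*} [DecidableEq V] {G : SimpleGraph V} {χ : V → Finset ℕ} {s v : V}

theorem mem_walkColors {p : G.Walk s v} {c : ℕ} :
    c ∈ walkColors χ p ↔ ∃ x ∈ p.support, c ∈ χ x := by
  simp [walkColors]

theorem walkColors_reverse (p : G.Walk s v) : walkColors χ p.reverse = walkColors χ p := by
  ext; simp [mem_walkColors]

/-- The prefixes of the three paths up to the predecessors of `w` serve as the sets `A j`; they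
avoid `w` and `w'` because paths do not repeat vertices. -/
theorem IsPlanar.no_three_backLinked (hG : IsPlanar G) (hχ : ColorConnected G χ)
    {p : Fin 3 → G.Walk s v} (hp : ∀ j, (p j).IsPath)
    (hd : ∀ i j, i ≠ j → Disjoint (walkColors χ (p i)) (walkColors χ (p j))) {w w' : V}
    (h : ∀ j, BackLinked χ (p j) w w') : False := by
  choose i l c b hil hl hiw hlw hci hcb hadj using h
  have hc : ∀ j, c j ∈ walkColors χ (p j) := fun j =>
    mem_walkColors.2 ⟨_, (p j).getVert_mem_support _, hci j⟩
  have hnot : ∀ i j, i ≠ j → ∀ x ∈ (p i).support, c j ∉ χ x := fun i j hij x hx hcx =>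
    Finset.disjoint_left.1 (hd i j hij) (mem_walkColors.2 ⟨x, hx, hcx⟩) (hc j)
  have hw : ∀ j, w ∈ (p j).support := fun j => hiw j ▸ (p j).getVert_mem_support _
  have hw' : ∀ j, w' ∈ (p j).support := fun j => hlw j ▸ (p j).getVert_mem_support _
  have hother : ∀ i : Fin 3, ∃ j, j ≠ i := by decide
  have hinj : ∀ j m n, m ≤ (p j).length → n ≤ (p j).length →
      (p j).getVert m = (p j).getVert n → m = n := fun j m n hm hn hmn =>
    (hp j).getVert_injOn hm hn hmn
  refine hG.no_color_linked_triple hχ (s := s) (w := w) (w' := w')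
    (a := fun j => (p j).getVert (i j)) (b := b) (c := c)
    (A := fun j => {x | ∃ t ≤ i j, (p j).getVert t = x})
    (fun j => (p j).reachable_induce_getVert (by have := hil j; have := hl j; omega)
      fun t ht => ⟨t, ht, rfl⟩) ?_ ?_ ?_ ?_ hadj hci hcb ?_ ?_ ?_
  · rintro j ⟨t, ht, h⟩
    have := hil j
    have := hl j
    have := hinj j t (i j + 1) (by omega) (by omega) (h.trans (hiw j).symm)
    omega
  · rintro j ⟨t, ht, h⟩
    have := hil j
    have := hl j
    have := hinj j t (l j) (by omega) (by omega) (h.trans (hlw j).symm)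
    omega
  · intro h
    have := hil 0
    have := hl 0
    have := hinj 0 (i 0 + 1) (l 0) (by omega) (by omega) (by rw [hiw, hlw, h])
    omega
  · intro j
    have := hil j
    have := hl j
    rw [← hiw j]
    exact ((p j).adj_getVert_succ (by omega)).symm
  -- Since `w` also lies on another of the paths, it cannot carry a color of this one; the same
  -- holds for `w'`.
  · intro j
    obtain ⟨j', h⟩ := hother j
    exact hnot j' j h _ (hw j')
  · intro j
    obtain ⟨j', h⟩ := hother j
    exact hnot j' j h _ (hw' j')
  · rintro j j' hj x ⟨t, -, rfl⟩
    exact hnot j j' hj _ ((p j).getVert_mem_support _)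

theorem exists_lt_lt_of_two_lt_card {α : Type*} {F : Finset α} (pos : α → ℕ)
    (hpos : Set.InjOn pos F) (hF : 2 < F.card) :
    ∃ a ∈ F, ∃ b ∈ F, ∃ c ∈ F, pos a < pos b ∧ pos b < pos c := by
  obtain ⟨a, ha, b, hb, c, hc, hab, hac, hbc⟩ := Finset.two_lt_card.1 hF
  have h1 := hpos.ne ha hb hab
  have h2 := hpos.ne ha hc hac
  have h3 := hpos.ne hb hc hbc
  rcases h1.lt_or_gt with h1 | h1 <;> rcases h2.lt_or_gt with h2 | h2 <;>
    rcases h3.lt_or_gt with h3 | h3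
  · exact ⟨a, ha, b, hb, c, hc, h1, h3⟩
  · exact ⟨a, ha, c, hc, b, hb, h2, h3⟩
  · omega
  · exact ⟨c, hc, a, ha, b, hb, h2, h1⟩
  · exact ⟨b, hb, a, ha, c, hc, h1, h2⟩
  · omega
  · exact ⟨b, hb, c, hc, a, ha, h3, h2⟩
  · exact ⟨c, hc, b, hb, a, ha, h3, h1⟩

/-- Among three vertices with the same picked color, the middle one has another on each side, so
whichever side its picked neighbor is on, a vertex beyond `w` in the opposite direction completes a
back link. -/
theorem exists_backLinked (hirr : ColorIrreducible G χ) {p : G.Walk s v} (hsv : s ≠ v) {k : ℕ}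
    (hk : IsValidWalk χ k p) {U : Finset V} (hU : 2 * k + 1 ≤ U.card)
    (hUp : ∀ w ∈ U, w ∈ p.support) (hχU : ∀ w ∈ U, χ w = ∅) :
    ∃ w ∈ U, ∃ w' ∈ U, BackLinked χ p w w' ∨ BackLinked χ p.reverse w w' := by
  have hlen : 0 < p.length := by
    rw [Nat.pos_iff_ne_zero]; exact fun h => hsv (SimpleGraph.Walk.eq_of_length_eq_zero h)
  let pos : V → ℕ := fun w => p.support.idxOf w
  have hpos : ∀ w ∈ U, p.getVert (pos w) = w := fun w hw => p.getVert_support_idxOf (hUp w hw)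
  have hposle : ∀ w ∈ U, pos w ≤ p.length := fun w hw => by
    have := List.idxOf_lt_length_iff.2 (hUp w hw)
    rw [p.length_support] at this
    exact Nat.lt_succ_iff.1 this
  -- The picked neighbor is the successor, or the predecessor when `w` is the last vertex; the path
  -- is not trivial because s ≠ v.
  have hcol : ∀ w : V, ∃ c t, w ∈ U → t ≤ p.length ∧ (t = pos w + 1 ∨ t + 1 = pos w) ∧
      c ∈ χ (p.getVert t) ∧ G.Adj w (p.getVert t) := by
    intro w
    by_cases hw : w ∈ U
    · have h2 : ∃ t, t ≤ p.length ∧ (t = pos w + 1 ∨ t + 1 = pos w) ∧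
          G.Adj w (p.getVert t) := by
        have hle := hposle w hw
        have hw' := hpos w hw
        rcases hle.lt_or_eq with h | h
        · refine ⟨pos w + 1, h, Or.inl rfl, ?_⟩
          have := p.adj_getVert_succ h
          rwa [hw'] at this
        · refine ⟨pos w - 1, by omega, Or.inr (by omega), ?_⟩
          have := p.adj_getVert_succ (i := pos w - 1) (by omega)
          rw [show pos w - 1 + 1 = pos w by omega, hw'] at this
          exact this.symm
      obtain ⟨t, ht, htpos, hadj⟩ := h2
      have hne : (χ (p.getVert t)).Nonempty := by
        rw [Finset.nonempty_iff_ne_empty, ← hχU w hw]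
        exact (hirr _ _ hadj).symm
      obtain ⟨c, hc⟩ := hne
      exact ⟨c, t, fun _ => ⟨ht, htpos, hc, hadj⟩⟩
    · exact ⟨0, 0, fun h => (hw h).elim⟩
  choose c t ht using hcol
  obtain ⟨c₀, -, hc₀⟩ := Finset.exists_lt_card_fiber_of_mul_lt_card_of_maps_to
    (s := U) (t := walkColors χ p) (f := c) (n := 2)
    (fun w hw => mem_walkColors.2 ⟨_, p.getVert_mem_support _, (ht w hw).2.2.1⟩)
    (by have : (walkColors χ p).card ≤ k := hk
        omega)
  obtain ⟨w₁, h₁, w₂, h₂, w₃, h₃, h12, h23⟩ := exists_lt_lt_of_two_lt_card pos (fun x hx y hy h => by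
    have hx' := hpos x (Finset.mem_filter.1 hx).1
    have hy' := hpos y (Finset.mem_filter.1 hy).1
    rw [← hx', ← hy', h]) hc₀
  rw [Finset.mem_filter] at h₁ h₂ h₃
  obtain ⟨h₁, hc₁⟩ := h₁
  obtain ⟨h₂, hc₂⟩ := h₂
  obtain ⟨h₃, hc₃⟩ := h₃
  have hle₂ := hposle _ h₂
  have hle₃ := hposle _ h₃
  obtain ⟨-, -, hb₁, ha₁⟩ := ht w₁ h₁
  obtain ⟨htl, htp, hb₂, ha₂⟩ := ht w₂ h₂
  obtain ⟨-, -, hb₃, ha₃⟩ := ht w₃ h₃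
  -- If the picked neighbor follows `w₂`, it precedes `w₂` on the reversed path, where `w₁` comes
  -- later.
  rcases htp with htp | htp
  · refine ⟨w₂, h₂, w₁, h₁, Or.inr ⟨p.length - t w₂, p.length - pos w₁, c₀, _, by omega, ?_, ?_, ?_,
      ?_, hc₁ ▸ hb₁, ha₁⟩⟩
    · simp
    · rw [SimpleGraph.Walk.getVert_reverse]
      refine Eq.trans ?_ (hpos w₂ h₂)
      congr 1; omega
    · rw [SimpleGraph.Walk.getVert_reverse]
      refine Eq.trans ?_ (hpos w₁ h₁)
      congr 1; omega
    · rw [SimpleGraph.Walk.getVert_reverse, ← hc₂]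
      convert hb₂ using 3
      omega
  · exact ⟨w₂, h₂, w₃, h₃, Or.inl ⟨t w₂, pos w₃, c₀, _, by omega, hle₃, by rw [htp, hpos _ h₂],
      hpos _ h₃, hc₂ ▸ hb₂, hc₃ ▸ hb₃, ha₃⟩⟩

theorem IsPlanar.card_le_of_common_vertices (hG : IsPlanar G) (hχ : ColorConnected G χ)
    (hirr : ColorIrreducible G χ) {k : ℕ} {Q : Finset (G.Path s v)}
    (hd : PairwiseColorDisjoint χ Q) (hk : ∀ p ∈ Q, IsValidWalk χ k p.1) {U : Finset V}
    (hU : U.card = 2 * k + 1) (hUQ : ∀ p ∈ Q, ∀ w ∈ U, w ∈ p.1.support) :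
    Q.card ≤ 4 * (2 * k + 1) ^ 2 := by
  by_contra! hcard
  obtain ⟨p₁, hp₁, p₂, hp₂, hne⟩ := Finset.one_lt_card.1
    (lt_of_le_of_lt (Nat.succ_le_of_lt (by positivity)) hcard)
  have hsv : s ≠ v := by
    rintro rfl
    exact hne (by rw [SimpleGraph.Path.loop_eq p₁, SimpleGraph.Path.loop_eq p₂])
  have hχU : ∀ w ∈ U, χ w = ∅ := by
    intro w hw
    rw [Finset.eq_empty_iff_forall_notMem]
    intro c hc
    exact Finset.disjoint_left.1 (hd _ hp₁ _ hp₂ hne) (mem_walkColors.2 ⟨w, hUQ _ hp₁ w hw, hc⟩)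
      (mem_walkColors.2 ⟨w, hUQ _ hp₂ w hw, hc⟩)
  have key : ∀ p : G.Path s v, ∃ z : V × V × Bool, p ∈ Q → z ∈ U ×ˢ U ×ˢ Finset.univ ∧
      ((z.2.2 = true ∧ BackLinked χ p.1 z.1 z.2.1) ∨
        (z.2.2 = false ∧ BackLinked χ p.1.reverse z.1 z.2.1)) := by
    intro p
    by_cases hp : p ∈ Q
    · obtain ⟨w, hw, w', hw', h | h⟩ :=
        exists_backLinked hirr hsv (hk p hp) hU.ge (hUQ p hp) hχU
      · exact ⟨(w, w', true), fun _ => ⟨by simp [hw, hw'], Or.inl ⟨rfl, h⟩⟩⟩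
      · exact ⟨(w, w', false), fun _ => ⟨by simp [hw, hw'], Or.inr ⟨rfl, h⟩⟩⟩
    · exact ⟨(s, s, true), fun h => (hp h).elim⟩
  choose z hz using key
  obtain ⟨y, -, hy⟩ := Finset.exists_lt_card_fiber_of_mul_lt_card_of_maps_to
    -- There are 2(2k+1)² triples (w, w', direction), so more than twice as many paths put three
    -- into one class.
    (s := Q) (f := z) (n := 2) (fun p hp => (hz p hp).1) (by
      simp only [Finset.card_product, hU, Finset.card_univ, Fintype.card_bool]
      linarith)
  obtain ⟨q₀, h₀, q₁, h₁, q₂, h₂, h01, h02, h12⟩ := Finset.two_lt_card.1 hy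
  let q : Fin 3 → G.Path s v := ![q₀, q₁, q₂]
  have hq : ∀ j, q j ∈ Q ∧ z (q j) = y := by
    intro j
    fin_cases j
    · exact Finset.mem_filter.1 h₀
    · exact Finset.mem_filter.1 h₁
    · exact Finset.mem_filter.1 h₂
  have hqne : ∀ i j, i ≠ j → q i ≠ q j := by
    intro i j hij
    fin_cases i <;> fin_cases j <;> first | exact (hij rfl).elim | skip
    exacts [h01, h02, h01.symm, h12, h02.symm, h12.symm]
  have hlink := fun j => (hq j).2 ▸ (hz _ (hq j).1).2
  have hdq : ∀ i j, i ≠ j → Disjoint (walkColors χ (q i).1) (walkColors χ (q j).1) :=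
    fun i j hij => hd _ (hq i).1 _ (hq j).1 (hqne i j hij)
  rcases hb : y.2.2 with _ | _
  · refine hG.no_three_backLinked hχ (p := fun j => (q j).1.reverse) (w := y.1) (w' := y.2.1)
      (fun j => (q j).2.reverse) (fun i j hij => ?_) (fun j => ?_)
    · rw [walkColors_reverse, walkColors_reverse]
      exact hdq i j hij
    · simpa [hb] using hlink j
  · exact hG.no_three_backLinked hχ (p := fun j => (q j).1) (w := y.1) (w' := y.2.1)
      (fun j => (q j).2) hdq (fun j => by simpa [hb] using hlink j)

end

/-! ### The size bound and the run of the algorithm -/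

/-- Each pass divides the number of paths by at most this factor, as long as `|U| ≤ 2 * k`. -/
def refineFactor (k : ℕ) : ℕ := (2 * k + 1)! * (8 * k ^ 2 + 8 * k + 3)

/-- The number of paths that suffices for the path-refining algorithm. -/
def refineBound (k : ℕ) : ℕ := (4 * (2 * k + 1) ^ 2 + 1) * refineFactor k ^ (2 * k + 1)

theorem refineBound_le {k : ℕ} (hk : 2 ≤ k) : refineBound k ≤ k ^ (31 * k ^ 2) := by
  have h1 : 2 * k + 1 ≤ k ^ 3 := by nlinarith [Nat.mul_le_mul hk hk]
  have h2 : (2 * k + 1) ^ 2 ≤ k ^ 6 := (Nat.pow_le_pow_left h1 2).trans_eq (by ring)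
  have h3 : 4 * (2 * k + 1) ^ 2 + 1 ≤ k ^ 9 := by
    have : 5 ≤ k ^ 3 := by nlinarith [Nat.mul_le_mul hk hk]
    calc 4 * (2 * k + 1) ^ 2 + 1 ≤ 5 * (2 * k + 1) ^ 2 := by nlinarith
      _ ≤ k ^ 3 * k ^ 6 := Nat.mul_le_mul this h2
      _ = k ^ 9 := by ring
  have h4 : 8 * k ^ 2 + 8 * k + 3 ≤ k ^ 8 := by
    have : 3 ≤ k ^ 2 := by nlinarith
    calc 8 * k ^ 2 + 8 * k + 3 ≤ 3 * (2 * k + 1) ^ 2 := by nlinarith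
      _ ≤ k ^ 2 * k ^ 6 := Nat.mul_le_mul this h2
      _ = k ^ 8 := by ring
  have h5 : (2 * k + 1)! ≤ k ^ (3 * (2 * k + 1)) := by
    rw [pow_mul]
    exact (Nat.factorial_le_pow _).trans (Nat.pow_le_pow_left h1 _)
  calc refineBound k
      ≤ k ^ 9 * (k ^ (3 * (2 * k + 1)) * k ^ 8) ^ (2 * k + 1) :=
        Nat.mul_le_mul h3 (Nat.pow_le_pow_left (Nat.mul_le_mul h5 h4) _)
    _ = k ^ (9 + (3 * (2 * k + 1) + 8) * (2 * k + 1)) := by rw [← pow_add, ← pow_mul, ← pow_add]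
    -- The exponent is 12k² + 28k + 20, which equals 31k² at k = 2.
    _ ≤ k ^ (31 * k ^ 2) := Nat.pow_le_pow_right (by omega) (by nlinarith)

section

variable {V : Type*} [DecidableEq V] {G : SimpleGraph V} {χ : V → Finset ℕ} {s v : V} {k : ℕ}

theorem RefineStep.card_U {a b : RefineState G s v} (h : RefineStep k a b) :
    b.U.card = a.U.card + 1 := by
  obtain ⟨u, hu, -, -, rfl⟩ := h
  exact Finset.card_insert_of_notMem hu

theorem RefineStep.card_Q_le {a b : RefineState G s v} (h : RefineStep k a b)
    (ha : a.U.card ≤ 2 * k) : a.Q.card ≤ b.Q.card * refineFactor k := by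
  obtain ⟨u, -, -, hlt, rfl⟩ := h
  have hpos : (0 : ℚ) < ((a.U.card + 1)! : ℚ) * (8 * (k : ℚ) ^ 2 + 8 * (k : ℚ) + 3) := by
    have := Nat.factorial_pos (a.U.card + 1)
    positivity
  rw [div_lt_iff₀ hpos] at hlt
  have h1 : a.Q.card ≤
      (pathsThrough a.Q u).card * ((a.U.card + 1)! * (8 * k ^ 2 + 8 * k + 3)) := by
    exact_mod_cast hlt.le
  exact h1.trans (Nat.mul_le_mul_left _
    (Nat.mul_le_mul_right _ (Nat.factorial_le (Nat.succ_le_succ ha))))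

theorem refineTerminates [Fintype V] (P : Finset (G.Path s v)) : RefineTerminates k P := by
  rintro ⟨run, -, hrun⟩
  have hcard : ∀ n, n ≤ (run n).U.card := by
    intro n
    induction n with
    | zero => exact Nat.zero_le _
    | succ n ih => rw [(hrun n).card_U]; omega
  have := (hcard (Fintype.card V + 1)).trans (Finset.card_le_univ _)
  omega

/-- Every state reached has at most `2 * k` vertices in `U`. -/
theorem refine_invariant {P : Finset (G.Path s v)} (hG : IsPlanar G) (hχ : ColorConnected G χ)
    (hirr : ColorIrreducible G χ) (hd : PairwiseColorDisjoint χ P)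
    (hk : ∀ p ∈ P, IsValidWalk χ k p.1) (hP : refineBound k ≤ P.card) {a : RefineState G s v}
    (h : Relation.ReflTransGen (RefineStep k) (refineInit P) a) :
    a.U.card ≤ 2 * k ∧ a.Q ⊆ P ∧ (∀ p ∈ a.Q, ∀ w ∈ a.U, w ∈ p.1.support) ∧
      P.card ≤ a.Q.card * refineFactor k ^ a.U.card := by
  induction h with
  | refl => simp [refineInit]
  | @tail a b _ hab ih =>
    obtain ⟨hU, hQ, hUQ, hcard⟩ := ih
    have hcardU := hab.card_U
    have hcardQ := hab.card_Q_le hU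
    have hQ' : b.Q ⊆ P := by
      obtain ⟨u, -, -, -, rfl⟩ := hab
      exact (Finset.filter_subset _ _).trans hQ
    have hUQ' : ∀ p ∈ b.Q, ∀ w ∈ b.U, w ∈ p.1.support := by
      obtain ⟨u, -, -, -, rfl⟩ := hab
      intro p hp w hw
      obtain ⟨hp, hpu⟩ := Finset.mem_filter.1 hp
      rcases Finset.mem_insert.1 hw with rfl | hw
      · exact hpu
      · exact hUQ p hp w hw
    have hcard' : P.card ≤ b.Q.card * refineFactor k ^ b.U.card := by
      rw [hcardU, pow_succ', ← mul_assoc]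
      exact hcard.trans (Nat.mul_le_mul_right _ hcardQ)
    refine ⟨?_, hQ', hUQ', hcard'⟩
    -- `U` grows by one vertex per pass, so a first violation has exactly 2k+1 vertices, and
    -- `refineBound` leaves one path too many.
    by_contra! hlt
    have hU' : b.U.card = 2 * k + 1 := by omega
    have := hG.card_le_of_common_vertices hχ hirr
      (fun p hp q hq => hd p (hQ' hp) q (hQ' hq)) (fun p hp => hk p (hQ' hp)) hU' hUQ'
    rw [hU'] at hcard'
    have hpos : 0 < refineFactor k ^ (2 * k + 1) := by
      have := Nat.factorial_pos (2 * k + 1)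
      unfold refineFactor
      positivity
    have := Nat.le_of_mul_le_mul_right (hP.trans hcard') hpos
    omega

end

theorem mainTheorem6 :
    ∃ f : ℕ → ℕ,
      (∃ c : ℕ, ∀ k : ℕ, 2 ≤ k → f k ≤ k ^ (c * k ^ 2)) ∧
      ∀ (V : Type*) [Fintype V] [DecidableEq V] (G : SimpleGraph V) (χ : V → Finset ℕ)
        (k : ℕ) (s v : V) (P : Finset (G.Path s v)),
        IsPlanar G → ColorConnected G χ → ColorIrreducible G χ →
        PairwiseColorDisjoint χ P → (∀ p ∈ P, IsValidWalk χ k p.1) →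
        f k ≤ P.card →
        RefineTerminates k P ∧
          ∀ a : RefineState G s v, RefineOutput k P a → a.U.card < 2 * k + 1 := by
  refine ⟨refineBound, ⟨31, fun k hk => refineBound_le hk⟩, ?_⟩
  intro V _ _ G χ k s v P hG hχ hirr hd hk hP
  exact ⟨refineTerminates P, fun a ha =>
    Nat.lt_succ_of_le (refine_invariant hG hχ hirr hd hk hP ha.1).1⟩
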